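/- A descending plane partition (DPP) is a finite (possibly empty) array of positive integers $A=(a_{i,j})_{1\le i\le r,\ i\le j\le \mu_i}$ with $r\ge 0$ non-empty rows, row $i$ occupying the columns $i,i+1,\dots,\mu_i$, such that $\mu_1\ge\mu_2\ge\dots\ge\mu_r$ and, with $\lambda_i=\mu_i-i+1$ (the number of parts of row $i$) and $\lambda_0=\infty$, $$a_{i,j}\ge a_{i,j+1},\qquad a_{i,j}>a_{i+1,j},\qquad \lambda_i<a_{i,i}\le\lambda_{i-1}$$ whenever the entries involved exist. The entries $a_{i,j}$ are called parts; $A$ is of order $n$ if all its parts are at most $n$. A part $a_{i,j}$ is special if $a_{i,j}\le j-i$. Let $S(A)$ and $NS(A)$ be the numbers of special and of non-special parts of $A$. Let $R$ be a commutative ring (for instance $\mathbb Z[x,y]$), let $x,y\in R$, and for every integer $n\ge 0$ put $$Z^{(n)}_{DPP}(x,y)=\sum_{A\ \text{DPP of order}\ n}x^{S(A)}y^{NS(A)},$$ a finite sum. **Theorem.** There is exactly one infinite matrix $H=(H_{i,j})_{i,j\ge 0}$ over $R$ such that $M_{DPP}=\mathbb I+H$ has, as a formal power series in $u,v$ over $R$,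 the generating function $$\sum_{i,j\ge 0}(M_{DPP})_{i,j}u^iv^j=\frac1{1-uv}+\frac1{1-u}\cdot\frac{yu}{1-xu-v-(y-x)uv},$$ and for this $H$ and every $n\ge 0$ $$Z^{(n)}_{DPP}(x,y)=\det\bigl(\mathbb I+H^{[0,n-1]}\bigr),$$ where $H^{[0,n-1]}=(H_{i,j})_{0\le i,j\le n-1}$ is the truncation of $H$ to its first $n$ rows and columns (for $n=0$ both sides equal $1$). -/

import Mathlib

/-- A descending plane partition: an array of positive integers `part i j` (a part for each
`1 ≤ i ≤ numRows`, `i ≤ j ≤ mu i`), shifted so that row `i` starts in column `i`, with weakly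
decreasing rows, strictly decreasing columns and `λ_i < a_{i,i} ≤ λ_{i-1}` (`λ_0 = ∞`), where
`λ_i = mu i - i + 1` is the number of parts of row `i`. Indices are 1-based. The fields `mu_eq_zero`
and `part_eq_zero` only fix the irrelevant values outside the array, so that two descending plane
partitions are equal exactly when they are the same array. -/
@[ext]
structure DPP where
  /-- the number of rows; `0` for the empty partition -/
  numRows : ℕ
  /-- `mu i` is the last column occupied by row `i` -/
  mu : ℕ → ℕ
  /-- `part i j` is the part in row `i` and column `j` -/
  part : ℕ → ℕ → ℕ
  mu_eq_zero : ∀ i, ¬ (1 ≤ i ∧ i ≤ numRows) → mu i = 0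
  part_eq_zero : ∀ i j, ¬ (1 ≤ i ∧ i ≤ numRows ∧ i ≤ j ∧ j ≤ mu i) → part i j = 0
  /-- every row is non-empty -/
  le_mu : ∀ i, 1 ≤ i → i ≤ numRows → i ≤ mu i
  mu_succ_le : ∀ i, 1 ≤ i → i + 1 ≤ numRows → mu (i + 1) ≤ mu i
  part_pos : ∀ i j, 1 ≤ i → i ≤ numRows → i ≤ j → j ≤ mu i → 0 < part i j
  row_weak : ∀ i j, 1 ≤ i → i ≤ numRows → i ≤ j → j + 1 ≤ mu i → part i (j + 1) ≤ part i j
  col_strict : ∀ i j, 1 ≤ i → i + 1 ≤ numRows → i + 1 ≤ j → j ≤ mu (i + 1) →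
    part (i + 1) j < part i j
  /-- `λ_i < a_{i,i}` -/
  lam_lt_diag : ∀ i, 1 ≤ i → i ≤ numRows → mu i + 1 - i < part i i
  /-- `a_{i+1,i+1} ≤ λ_i` -/
  diag_succ_le_lam : ∀ i, 1 ≤ i → i + 1 ≤ numRows → part (i + 1) (i + 1) ≤ mu i + 1 - i

namespace DPP

/-- All parts are at most `n`. -/
def IsOfOrder (A : DPP) (n : ℕ) : Prop :=
  ∀ i j, 1 ≤ i → i ≤ A.numRows → i ≤ j → j ≤ A.mu i → A.part i j ≤ n

/-- The number of special parts, i.e. of parts with `a_{i,j} ≤ j - i`. -/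
def numSpecial (A : DPP) : ℕ :=
  ∑ i ∈ Finset.Icc 1 A.numRows,
    ((Finset.Icc i (A.mu i)).filter fun j => A.part i j ≤ j - i).card

/-- The number of non-special parts. -/
def numNonSpecial (A : DPP) : ℕ :=
  ∑ i ∈ Finset.Icc 1 A.numRows,
    ((Finset.Icc i (A.mu i)).filter fun j => ¬ A.part i j ≤ j - i).card

theorem mu_lt_of_isOfOrder {A : DPP} {n : ℕ} (h : A.IsOfOrder n) :
    ∀ i, 1 ≤ i → i ≤ A.numRows → A.mu i < n := by
  intro i hi
  induction i, hi using Nat.le_induction with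
  | base =>
    intro hr
    have h1 := A.lam_lt_diag 1 le_rfl hr
    have h2 := h 1 1 le_rfl hr le_rfl (A.le_mu 1 le_rfl hr)
    omega
  | succ i hi ih =>
    intro hr
    exact (A.mu_succ_le i hi hr).trans_lt (ih (by omega))

/-- There are finitely many descending plane partitions of order `n`. -/
theorem finite_isOfOrder (n : ℕ) : {A : DPP | A.IsOfOrder n}.Finite := by
  have hmu : ∀ A : DPP, A.IsOfOrder n → ∀ i, A.mu i < n + 1 := by
    intro A h i
    by_cases hi : 1 ≤ i ∧ i ≤ A.numRows
    · have := mu_lt_of_isOfOrder h i hi.1 hi.2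
      omega
    · rw [A.mu_eq_zero i hi]; omega
  have hr : ∀ A : DPP, A.IsOfOrder n → A.numRows < n + 1 := by
    intro A h
    by_cases h0 : A.numRows = 0
    · omega
    · have h1 := A.le_mu A.numRows (by omega) le_rfl
      have h2 := hmu A h A.numRows
      omega
  have hp : ∀ A : DPP, A.IsOfOrder n → ∀ i j, A.part i j < n + 1 := by
    intro A h i j
    by_cases hi : 1 ≤ i ∧ i ≤ A.numRows ∧ i ≤ j ∧ j ≤ A.mu i
    · have := h i j hi.1 hi.2.1 hi.2.2.1 hi.2.2.2
      omega
    · rw [A.part_eq_zero i j hi]; omega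
  let f : {A : DPP | A.IsOfOrder n} → Fin (n + 1) × (Fin (n + 1) → Fin (n + 1)) ×
      (Fin (n + 1) → Fin (n + 1) → Fin (n + 1)) := fun A =>
    (⟨A.1.numRows, hr A.1 A.2⟩, fun i => ⟨A.1.mu i, hmu A.1 A.2 i⟩,
      fun i j => ⟨A.1.part i j, hp A.1 A.2 i j⟩)
  refine Set.finite_coe_iff.mp (Finite.of_injective f ?_)
  rintro ⟨A, hA⟩ ⟨B, hB⟩ hAB
  simp only [f, Prod.mk.injEq, Fin.mk.injEq, funext_iff] at hAB
  obtain ⟨h1, h2, h3⟩ := hAB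
  have hm : A.mu = B.mu := by
    funext i
    by_cases hi : i < n + 1
    · exact h2 ⟨i, hi⟩
    · have ha := hr A hA
      have hb := hr B hB
      rw [A.mu_eq_zero i (by omega), B.mu_eq_zero i (by omega)]
  have hq : A.part = B.part := by
    funext i j
    by_cases hij : i < n + 1 ∧ j < n + 1
    · exact h3 ⟨i, hij.1⟩ ⟨j, hij.2⟩
    · have ha := hr A hA
      have hb := hr B hB
      have ha' := hmu A hA i
      have hb' := hmu B hB i
      rw [A.part_eq_zero i j (by omega), B.part_eq_zero i j (by omega)]
  exact Subtype.ext (DPP.ext h1 hm hq)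

/-- The partition function of descending plane partitions of order `n`, with weight `x` per
special part and `y` per non-special part. -/
noncomputable def partitionFunction {R : Type*} [CommRing R] (x y : R) (n : ℕ) : R :=
  ∑ A ∈ (finite_isOfOrder n).toFinset, x ^ A.numSpecial * y ^ A.numNonSpecial

end DPP

/-- The generating function `∑ M_{i,j} u^i v^j` of an infinite matrix, as a formal power series in
`u = X 0` and `v = X 1`. -/
def matrixGenFun {R : Type*} (M : Matrix ℕ ℕ R) : MvPowerSeries (Fin 2) R :=
  fun m => M (m 0) (m 1)

/-- The formal power series
`1 / (1 - u v) + 1 / (1 - u) * (y u / (1 - x u - v - (y - x) u v))` in `u = X 0` and `v = X 1`.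
Every denominator has constant coefficient `1`, so `MvPowerSeries.invOfUnit _ 1` is its inverse. -/
noncomputable def dppGenFun {R : Type*} [CommRing R] (x y : R) : MvPowerSeries (Fin 2) R :=
  let u : MvPowerSeries (Fin 2) R := MvPowerSeries.X 0
  let v : MvPowerSeries (Fin 2) R := MvPowerSeries.X 1
  let c : R → MvPowerSeries (Fin 2) R := fun r => MvPowerSeries.C r
  MvPowerSeries.invOfUnit (1 - u * v) 1 +
    MvPowerSeries.invOfUnit (1 - u) 1 *
      (c y * u * MvPowerSeries.invOfUnit (1 - c x * u - v - c (y - x) * u * v) 1)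

/-- The truncation of an infinite matrix to its first `n` rows and columns. -/
def truncation {R : Type*} (M : Matrix ℕ ℕ R) (n : ℕ) : Matrix (Fin n) (Fin n) R :=
  M.submatrix Fin.val Fin.val

open Finset

/-! Expand det(1 + H) into principal minors. The minor on S ⊆ {0, …, n-1} turns out to enumerate the
partitions whose diagonal parts are the t + 1 with t ∈ S (`sum_weight_of_diagSet_eq`). Diagonal
parts strictly decrease, so each partition of order n belongs to exactly one S.

Fix S = {s 0 > s 1 > ⋯} and pad row k with zeros to length s k. The row fits because λ_i < a_{i,i},
and a_{i+1,i+1} ≤ λ_i extends column strictness to the padding. The padded rows are thus exactly the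
arrays of non-intersecting lattice paths (`isPathArray_rowArray`, `exists_dpp`).

That a determinant of path weights enumerates such arrays (`exists_finset_isPathArray`) is the
Lindström–Gessel–Viennot principle, proved by induction over columns instead of a sign-reversing
involution. Every entry is a sum over the next height; subtracting adjacent rows leaves sums over
interlacing intervals, and multilinearity then selects the next column of the array.

The weight of a part depends only on its size and its position in the row, so the path weights have
a closed generating function (`mk_pathWeight_eq`). It is geometric in the starting height, which
yields the stated rational function (`matrixGenFun_one_add_rowMatrix`). -/

/-! ### Row subtraction and interlacing sums -/

theorem Matrix.det_eq_of_forall_row_eq_sub_next {R : Type*} [CommRing R] {n : ℕ}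
    {A B : Matrix (Fin (n + 1)) (Fin (n + 1)) R}
    (hlast : ∀ j, B (Fin.last n) j = A (Fin.last n) j)
    (hcast : ∀ (i : Fin n) (j), B i.castSucc j = A i.castSucc j - A i.succ j) :
    A.det = B.det := by
  -- Rows are reversed because `det_eq_of_forall_row_eq_smul_add_pred` works with the preceding row,
  -- not the next one.
  rw [← Matrix.det_submatrix_equiv_self Fin.revPerm A,
    ← Matrix.det_submatrix_equiv_self Fin.revPerm B]
  refine Matrix.det_eq_of_forall_row_eq_smul_add_pred (fun _ => 1) (fun j => ?_) fun i j => ?_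
  · simp [hlast]
  · simp only [Matrix.submatrix_apply, Fin.revPerm_apply, Fin.rev_succ, Fin.rev_castSucc, hcast,
      one_mul, sub_add_cancel]

/-- The possible heights of the `k`-th of a family of non-intersecting lattice paths one step
after these had the heights `e 0 > e 1 > ⋯`. -/
def interlacing {r : ℕ} (e : Fin r → ℕ) (k : ℕ) (hk : k < r) : Finset ℕ :=
  (range (e ⟨k, hk⟩ + 1)).filter fun a => ∀ h : k + 1 < r, e ⟨k + 1, h⟩ < a

theorem sum_interlacing {M : Type*} [AddCommGroup M] {r : ℕ} {e : Fin r → ℕ} (he : Antitone e)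
    (f : ℕ → M) (k : ℕ) (hk : k + 1 < r) :
    ∑ a ∈ interlacing e k (by omega), f a =
      ∑ a ∈ range (e ⟨k, by omega⟩ + 1), f a - ∑ a ∈ range (e ⟨k + 1, hk⟩ + 1), f a := by
  have hle : e ⟨k + 1, hk⟩ ≤ e ⟨k, by omega⟩ := he (by simp)
  rw [← Finset.sum_sdiff_eq_sub (by simpa using hle)]
  refine Finset.sum_congr ?_ fun _ _ => rfl
  ext a
  simp only [interlacing, mem_filter, mem_range, mem_sdiff]
  constructor
  · rintro ⟨h1, h2⟩
    have := h2 hk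
    omega
  · rintro ⟨h1, h2⟩
    exact ⟨h1, fun _ => by omega⟩

theorem interlacing_last {n : ℕ} (e : Fin (n + 1) → ℕ) :
    interlacing e n (by omega) = range (e (Fin.last n) + 1) := by
  ext a
  simp only [interlacing, mem_filter, mem_range]
  exact ⟨fun h => h.1, fun h => ⟨h, fun h' => by omega⟩⟩

theorem Matrix.det_sum_rows {R : Type*} [CommRing R] {n : ℕ} (I : Fin n → Finset ℕ)
    (f : ℕ → Fin n → R) :
    (Matrix.of fun k l => ∑ a ∈ I k, f a l).det =
      ∑ a ∈ Fintype.piFinset I, (Matrix.of fun k l => f (a k) l).det := by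
  have := (Matrix.detRowAlternating (n := Fin n) (R := R)).toMultilinearMap.map_sum_finset
    (fun _ a => f a) I
  have hrow : (Matrix.of fun k l => ∑ a ∈ I k, f a l) = fun k => ∑ a ∈ I k, f a := by
    ext k l
    simp
  rw [hrow]
  exact this

/-- Subtracting the next row cuts each range down to an interlacing interval. Weak decrease of `e`
suffices: if two neighbours agree, the interval is empty and both sides vanish. -/
theorem det_sum_range_eq_sum_interlacing {R : Type*} [CommRing R] {r : ℕ} {e : Fin r → ℕ}
    (he : Antitone e) (f : ℕ → Fin r → R) :
    (Matrix.of fun k l => ∑ a ∈ range (e k + 1), f a l).det =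
      ∑ a ∈ Fintype.piFinset fun k : Fin r => interlacing e k k.2,
        (Matrix.of fun k l => f (a k) l).det := by
  rw [← Matrix.det_sum_rows]
  cases r with
  | zero => simp
  | succ n =>
    refine Matrix.det_eq_of_forall_row_eq_sub_next (fun j => ?_) fun i j => ?_
    · simp only [Matrix.of_apply, Fin.val_last, interlacing_last]
    · exact sum_interlacing he (fun a => f a j) i (by omega)

theorem Matrix.det_eq_det_castSucc_of_last_col {R : Type*} [CommRing R] {n : ℕ}
    {A : Matrix (Fin (n + 1)) (Fin (n + 1)) R} (h1 : A (Fin.last n) (Fin.last n) = 1)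
    (h0 : ∀ i : Fin n, A i.castSucc (Fin.last n) = 0) :
    A.det = (A.submatrix Fin.castSucc Fin.castSucc).det := by
  rw [Matrix.det_succ_column A (Fin.last n), Fin.sum_univ_castSucc]
  have hev : (-1 : R) ^ (n + n) = 1 := Even.neg_one_pow ⟨n, rfl⟩
  have hs : (Fin.last n).succAbove = Fin.castSucc := by
    funext i
    simp
  simp [h0, h1, hev, hs]

/-- Treats the case where the last path ends in the present column. Row subtraction turns the
constant last column into (0, …, 0, 1), and expansion along it drops that path; its height still
bounds the interval above it. -/
theorem det_last_col_one_eq_sum_interlacing {R : Type*} [CommRing R] {n : ℕ}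
    {e : Fin (n + 1) → ℕ} (he : Antitone e) (f : ℕ → Fin n → R)
    {A : Matrix (Fin (n + 1)) (Fin (n + 1)) R} (hlast : ∀ k, A k (Fin.last n) = 1)
    (hA : ∀ k (l : Fin n), A k l.castSucc = ∑ a ∈ range (e k + 1), f a l) :
    A.det = ∑ a ∈ Fintype.piFinset fun k : Fin n => interlacing e k (by omega),
        (Matrix.of fun k l => f (a k) l).det := by
  rw [← Matrix.det_sum_rows]
  let B : Matrix (Fin (n + 1)) (Fin (n + 1)) R := fun k l =>
    Fin.lastCases (A (Fin.last n) l) (fun i => A i.castSucc l - A i.succ l) k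
  rw [Matrix.det_eq_of_forall_row_eq_sub_next (A := A) (B := B) (by simp [B]) (by simp [B]),
    Matrix.det_eq_det_castSucc_of_last_col (A := B) (by simp [B, hlast]) (by simp [B, hlast])]
  congr 1
  ext k l
  have hB : B k.castSucc l.castSucc = A k.castSucc l.castSucc - A k.succ l.castSucc := by simp [B]
  rw [Matrix.submatrix_apply, hB, hA, hA]
  exact (sum_interlacing he (fun a => f a l) k (by omega)).symm

/-! ### Non-intersecting lattice paths -/

/-- The weight of all lattice paths which start at height `e` in column `c` and make `d` horizontal
steps, each followed or preceded by any number of steps down, ending at height `0`; a horizontal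
step that leads at height `a` into column `c'` has weight `w c' a`. -/
def pathWeight {R : Type*} [CommRing R] (w : ℕ → ℕ → R) : ℕ → ℕ → ℕ → R
  | 0, _, _ => 1
  | d + 1, c, e => ∑ a ∈ range (e + 1), w (c + 1) a * pathWeight w d (c + 1) a

/-- The heights `h k c` (`k < r`, `c₀ ≤ c ≤ s k`) of `r` non-intersecting lattice paths, the `k`-th
of which leads from height `e k` in column `c₀` to height `0` in column `s k`. -/
structure IsPathArray (s : ℕ → ℕ) (c₀ r : ℕ) (e : Fin r → ℕ) (h : ℕ → ℕ → ℕ) : Prop where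
  eq_zero : ∀ k c, ¬ (k < r ∧ c₀ ≤ c ∧ c ≤ s k) → h k c = 0
  start : ∀ k (hk : k < r), h k c₀ = e ⟨k, hk⟩
  row : ∀ k c, k < r → c₀ ≤ c → c + 1 ≤ s k → h k (c + 1) ≤ h k c
  col : ∀ k c, k + 1 < r → c₀ ≤ c → c ≤ s (k + 1) → h (k + 1) c < h k (c + 1)

/-- Put the column `e` in front of a path array. -/
def consColumn {r : ℕ} (c₀ : ℕ) (e : Fin r → ℕ) (h : ℕ → ℕ → ℕ) : ℕ → ℕ → ℕ := fun k c =>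
  if hk : k < r ∧ c = c₀ then e ⟨k, hk.1⟩ else h k c

/-- The conditions linking column `c₀` to the next are precisely interlacing. Only the `r'` paths
that go beyond `c₀` continue, but all `r` initial heights act as bounds. -/
theorem isPathArray_iff_exists_consColumn {s : ℕ → ℕ} {c₀ r r' : ℕ} {e : Fin r → ℕ}
    (hs : ∀ k l, k < l → l < r → s l < s k) (hc : ∀ k, k < r → c₀ ≤ s k)
    (hrr : r' ≤ r) (hr' : ∀ k, k < r' ↔ k < r ∧ c₀ < s k) (h : ℕ → ℕ → ℕ) :
    IsPathArray s c₀ r e h ↔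
      ∃ a ∈ Fintype.piFinset fun k : Fin r' => interlacing e k (by omega),
        ∃ g, IsPathArray s (c₀ + 1) r' a g ∧ consColumn c₀ e g = h := by
  constructor
  · intro hh
    refine ⟨fun k => h k (c₀ + 1), ?_, fun k c => if c = c₀ then 0 else h k c,
      ⟨?_, ?_, ?_, ?_⟩, ?_⟩
    · rw [Fintype.mem_piFinset]
      intro k
      have hk := (hr' k).1 k.2
      simp only [interlacing, mem_filter, mem_range]
      refine ⟨?_, fun h1 => ?_⟩
      · have := hh.row k c₀ hk.1 le_rfl hk.2
        rw [hh.start k hk.1] at this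
        omega
      · have := hh.col k c₀ h1 le_rfl (hc _ h1)
        rwa [hh.start (k + 1) h1] at this
    · intro k c hkc
      split_ifs with h1
      · rfl
      · refine hh.eq_zero k c fun h2 => hkc ⟨(hr' k).2 ⟨h2.1, ?_⟩, ?_, h2.2.2⟩ <;> omega
    · intro k hk
      simp
    · intro k c hk h1 h2
      have h3 := ((hr' k).1 hk).1
      rw [if_neg (by omega), if_neg (by omega)]
      exact hh.row k c h3 (by omega) h2
    · intro k c hk h1 h2
      rw [if_neg (by omega), if_neg (by omega)]
      exact hh.col k c (by omega) (by omega) h2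
    · funext k c
      simp only [consColumn]
      split_ifs with h1 h2
      · obtain ⟨hk, rfl⟩ := h1
        rw [hh.start k hk]
      · exact (hh.eq_zero k c (by omega)).symm
      · rfl
  · rintro ⟨a, ha, g, hg, rfl⟩
    rw [Fintype.mem_piFinset] at ha
    have hmem : ∀ k (hk : k < r'), a ⟨k, hk⟩ ≤ e ⟨k, by omega⟩ ∧
        ∀ h : k + 1 < r, e ⟨k + 1, h⟩ < a ⟨k, hk⟩ := by
      intro k hk
      have := ha ⟨k, hk⟩
      simp only [interlacing, mem_filter, mem_range] at this
      exact ⟨by omega, this.2⟩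
    refine ⟨?_, ?_, ?_, ?_⟩
    · intro k c hkc
      rw [consColumn, dif_neg]
      · refine hg.eq_zero k c fun h2 => hkc ⟨?_, ?_, h2.2.2⟩ <;> omega
      · rintro ⟨h1, rfl⟩
        exact hkc ⟨h1, le_rfl, hc k h1⟩
    · intro k hk
      simp [consColumn, hk]
    · intro k c hk h1 h2
      have hk' : k < r' := (hr' k).2 ⟨hk, by omega⟩
      rw [consColumn, dif_neg (by omega)]
      by_cases h3 : c = c₀
      · subst h3
        rw [consColumn, dif_pos ⟨hk, rfl⟩, hg.start k hk']
        exact (hmem k hk').1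
      · rw [consColumn, dif_neg (by omega)]
        exact hg.row k c hk' (by omega) h2
    · intro k c hk h1 h2
      have hlt := hs k (k + 1) (by omega) hk
      have hk' : k < r' := (hr' k).2 ⟨by omega, by omega⟩
      have h4 : consColumn c₀ e g k (c + 1) = g k (c + 1) := by
        rw [consColumn, dif_neg (by omega)]
      rw [h4]
      by_cases h3 : c = c₀
      · subst h3
        rw [consColumn, dif_pos ⟨hk, rfl⟩, hg.start k hk']
        exact (hmem k hk').2 hk
      · rw [consColumn, dif_neg (by omega)]
        exact hg.col k c ((hr' _).2 ⟨hk, by omega⟩) (by omega) h2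

/-- The weight of a path array, without its initial column. -/
def arrayWeight {R : Type*} [CommRing R] (w : ℕ → ℕ → R) (s : ℕ → ℕ) (c₀ r : ℕ)
    (h : ℕ → ℕ → ℕ) : R :=
  ∏ k ∈ range r, ∏ c ∈ Ioc c₀ (s k), w c (h k c)

theorem arrayWeight_consColumn {R : Type*} [CommRing R] (w : ℕ → ℕ → R) {s : ℕ → ℕ} {c₀ r r' : ℕ}
    (e : Fin r → ℕ) (hrr : r' ≤ r) (hr' : ∀ k, k < r' ↔ k < r ∧ c₀ < s k) {a : Fin r' → ℕ}
    {g : ℕ → ℕ → ℕ} (hg : IsPathArray s (c₀ + 1) r' a g) :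
    arrayWeight w s c₀ r (consColumn c₀ e g) =
      (∏ k, w (c₀ + 1) (a k)) * arrayWeight w s (c₀ + 1) r' g := by
  have h1 : arrayWeight w s c₀ r (consColumn c₀ e g) =
      ∏ k ∈ range r', ∏ c ∈ Ioc c₀ (s k), w c (g k c) := by
    rw [arrayWeight]
    symm
    have hcol : ∀ k, ∏ c ∈ Ioc c₀ (s k), w c (consColumn c₀ e g k c) =
        ∏ c ∈ Ioc c₀ (s k), w c (g k c) := fun k => Finset.prod_congr rfl fun c hc => by
      rw [mem_Ioc] at hc
      rw [consColumn, dif_neg (by omega)]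
    simp only [hcol]
    refine Finset.prod_subset (by simpa using hrr) fun k hk hk' => ?_
    rw [mem_range] at hk hk'
    have : ¬ c₀ < s k := fun h => hk' ((hr' k).2 ⟨hk, h⟩)
    rw [Ioc_eq_empty this, prod_empty]
  rw [h1, ← Fin.prod_univ_eq_prod_range (fun k => ∏ c ∈ Ioc c₀ (s k), w c (g k c)), arrayWeight,
    ← Fin.prod_univ_eq_prod_range (fun k => ∏ c ∈ Ioc (c₀ + 1) (s k), w c (g k c)),
    ← Finset.prod_mul_distrib]
  refine Finset.prod_congr rfl fun k _ => ?_
  have hk := ((hr' k).1 k.2).2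
  rw [← hg.start k k.2, ← Finset.prod_insert (f := fun c => w c (g k c)) (by simp)]
  congr 1
  ext c
  simp only [mem_Ioc, mem_insert]
  omega

theorem antitone_of_mem_interlacing {r r' : ℕ} {e : Fin r → ℕ} (hrr : r' ≤ r) {a : Fin r' → ℕ}
    (ha : a ∈ Fintype.piFinset fun k : Fin r' => interlacing e k (by omega)) : Antitone a := by
  rw [Fintype.mem_piFinset] at ha
  cases r' with
  | zero => exact fun k => k.elim0
  | succ n =>
    rw [Fin.antitone_iff_succ_le]
    intro k
    have h1 := ha k.castSucc
    have h2 := ha k.succ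
    simp only [interlacing, mem_filter, mem_range, Fin.val_castSucc, Fin.val_succ] at h1 h2
    have := h1.2 (by omega)
    omega

theorem isPathArray_zero_iff {s : ℕ → ℕ} {c₀ : ℕ} {e : Fin 0 → ℕ} {h : ℕ → ℕ → ℕ} :
    IsPathArray s c₀ 0 e h ↔ h = 0 := by
  constructor
  · intro hh
    funext k c
    exact hh.eq_zero k c (by omega)
  · rintro rfl
    constructor <;> intros <;> first | rfl | omega

/-- A determinant of path weights enumerates non-intersecting lattice paths. -/
theorem exists_finset_isPathArray {R : Type*} [CommRing R] (w : ℕ → ℕ → R) (s : ℕ → ℕ) (d : ℕ) :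
    ∀ (c₀ r : ℕ) (e : Fin r → ℕ), Antitone e → (∀ k l, k < l → l < r → s l < s k) →
      (∀ k, k < r → c₀ ≤ s k ∧ s k < c₀ + d) →
      ∃ F : Finset (ℕ → ℕ → ℕ), (∀ h, h ∈ F ↔ IsPathArray s c₀ r e h) ∧
        ∑ h ∈ F, arrayWeight w s c₀ r h =
          (Matrix.of fun k l : Fin r => pathWeight w (s l - c₀) c₀ (e k)).det := by
  classical
  induction d with
  | zero =>
    intro c₀ r e _ _ hc
    obtain rfl : r = 0 := by
      by_contra hr
      have := hc 0 (by omega)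
      omega
    exact ⟨{0}, fun h => by rw [isPathArray_zero_iff, mem_singleton], by simp [arrayWeight]⟩
  | succ d ih =>
    intro c₀ r e he hs hc
    have step : ∀ r' (hrr : r' ≤ r), (∀ k, k < r' ↔ k < r ∧ c₀ < s k) →
        (Matrix.of fun k l : Fin r => pathWeight w (s l - c₀) c₀ (e k)).det =
          ∑ a ∈ Fintype.piFinset fun k : Fin r' => interlacing e k (by omega),
            (Matrix.of fun k l : Fin r' => w (c₀ + 1) (a k) *
              pathWeight w (s l - (c₀ + 1)) (c₀ + 1) (a k)).det →
        ∃ F : Finset (ℕ → ℕ → ℕ), (∀ h, h ∈ F ↔ IsPathArray s c₀ r e h) ∧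
        ∑ h ∈ F, arrayWeight w s c₀ r h =
          (Matrix.of fun k l : Fin r => pathWeight w (s l - c₀) c₀ (e k)).det := by
      intro r' hrr hr' hdet
      -- Membership of `a` is required only inside the existential, so that `choose` yields a total
      -- function `F`.
      have ih' : ∀ a : Fin r' → ℕ, ∃ F : Finset (ℕ → ℕ → ℕ),
          a ∈ Fintype.piFinset (fun k : Fin r' => interlacing e k (by omega)) →
          (∀ h, h ∈ F ↔ IsPathArray s (c₀ + 1) r' a h) ∧
          ∑ h ∈ F, arrayWeight w s (c₀ + 1) r' h =
            (Matrix.of fun k l : Fin r' =>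
              pathWeight w (s l - (c₀ + 1)) (c₀ + 1) (a k)).det := by
        intro a
        by_cases ha : a ∈ Fintype.piFinset (fun k : Fin r' => interlacing e k (by omega))
        · obtain ⟨F, hF⟩ := ih (c₀ + 1) r' a (antitone_of_mem_interlacing hrr ha)
            (fun k l hkl hl => hs k l hkl (by omega)) fun k hk => by
              have h1 := (hr' k).1 hk
              have h2 := hc k h1.1
              omega
          exact ⟨F, fun _ => hF⟩
        · exact ⟨∅, fun h => absurd h ha⟩
      choose F hF using ih'
      have hinj : ∀ a a' g g', IsPathArray s (c₀ + 1) r' a g → IsPathArray s (c₀ + 1) r' a' g' →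
          consColumn c₀ e g = consColumn c₀ e g' → g = g' := by
        intro a a' g g' hg hg' h
        funext k c
        -- Only column `c₀` is overwritten, and there both arrays vanish.
        by_cases hcc : c = c₀
        · rw [hg.eq_zero k c (by omega), hg'.eq_zero k c (by omega)]
        · have := congrFun (congrFun h k) c
          rwa [consColumn, consColumn, dif_neg (by omega), dif_neg (by omega)] at this
      refine ⟨(Fintype.piFinset fun k : Fin r' => interlacing e k (by omega)).biUnion fun a =>
        (F a).image (consColumn c₀ e), fun h => ?_, ?_⟩
      · rw [isPathArray_iff_exists_consColumn hs (fun k hk => (hc k hk).1) hrr hr']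
        simp only [mem_biUnion, mem_image]
        refine exists_congr fun a => and_congr_right fun ha => exists_congr fun g => ?_
        rw [(hF a ha).1]
      · rw [Finset.sum_biUnion, hdet]
        · refine Finset.sum_congr rfl fun a ha => ?_
          rw [Finset.sum_image fun g hg g' hg' h => hinj a a g g' (((hF a ha).1 g).1 hg)
            (((hF a ha).1 g').1 hg') h]
          refine Eq.trans ?_ (Matrix.det_mul_column (fun k => w (c₀ + 1) (a k))
            (Matrix.of fun k l : Fin r' => pathWeight w (s l - (c₀ + 1)) (c₀ + 1) (a k))).symm
          rw [← (hF a ha).2, Finset.mul_sum]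
          exact Finset.sum_congr rfl fun g hg =>
            arrayWeight_consColumn w e hrr hr' (((hF a ha).1 g).1 hg)
        · intro a ha a' ha' hne
          rw [Function.onFun, Finset.disjoint_left]
          intro h h1 h2
          obtain ⟨g, hg, rfl⟩ := mem_image.1 h1
          obtain ⟨g', hg', hgg⟩ := mem_image.1 h2
          have hg := ((hF a ha).1 g).1 hg
          have hg' := ((hF a' ha').1 g').1 hg'
          obtain rfl := hinj _ _ _ _ hg' hg hgg
          refine hne (funext fun k => ?_)
          rw [← hg.start k k.2, ← hg'.start k k.2]
    have hpw : ∀ l, c₀ < s l → ∀ t, pathWeight w (s l - c₀) c₀ t = ∑ a ∈ range (t + 1),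
        w (c₀ + 1) a * pathWeight w (s l - (c₀ + 1)) (c₀ + 1) a := by
      intro l hl t
      rw [show s l - c₀ = (s l - (c₀ + 1)) + 1 by omega, pathWeight]
    by_cases hlast : ∀ k, k < r → c₀ < s k
    · refine step r le_rfl (fun k => ⟨fun h => ⟨h, hlast k h⟩, fun h => h.1⟩) ?_
      rw [← det_sum_range_eq_sum_interlacing he (fun a (l : Fin r) =>
        w (c₀ + 1) a * pathWeight w (s l - (c₀ + 1)) (c₀ + 1) a)]
      congr 1
      ext k l
      exact hpw l (hlast l l.2) _
    -- As `s` strictly decreases, only the last path can end in column `c₀`.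
    · push Not at hlast
      obtain ⟨k₀, hk₀, hle⟩ := hlast
      obtain ⟨n, rfl⟩ : ∃ n, r = n + 1 := ⟨r - 1, by omega⟩
      have hsk₀ : s k₀ = c₀ := le_antisymm hle (hc k₀ hk₀).1
      obtain rfl : k₀ = n := by
        by_contra hne
        have h1 := hs k₀ n (by omega) (by omega)
        have h2 := hc n (by omega)
        omega
      have hlt : ∀ k, k < k₀ → c₀ < s k := fun k hk => hsk₀ ▸ hs k k₀ hk hk₀
      refine step k₀ (by omega) (fun k => ⟨fun h => ⟨by omega, hlt k h⟩, fun h => ?_⟩) ?_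
      · by_contra hk
        obtain rfl : k = k₀ := by omega
        omega
      · refine det_last_col_one_eq_sum_interlacing he (fun a (l : Fin k₀) =>
          w (c₀ + 1) a * pathWeight w (s l - (c₀ + 1)) (c₀ + 1) a) (fun k => ?_) fun k l => ?_
        · simp [hsk₀, pathWeight]
        · exact hpw l (hlt l l.2) _

/-! ### Generating function of the path weights -/

/-- The weight of a part `a` in position `c` (counted from `1`) of a row of a descending plane
partition, where rows are padded by zeros. -/
def dppWeight {R : Type*} [CommRing R] (x y : R) (c a : ℕ) : R :=
  if a = 0 then 1 else if a < c then x else y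

section GeneratingFunction

open PowerSeries

variable {R : Type*} [CommRing R]

/-- The closed form obeys the recursion that splits off the first horizontal step. Raising `e` by
one adds a summand of weight `x` if `e < c` and `y` otherwise; correspondingly the left side gains a
factor `Q` or `1 + C y * X * Q`. -/
theorem inv_one_sub_eq_one_add_sum (x y : R) {N Q : R⟦X⟧} (hN : N * (1 - X) = 1)
    (hQ : Q * (1 - C x * X) = 1) (c e : ℕ) :
    N * Q ^ min c e * (1 + C y * X * Q) ^ (e - c) = 1 + X * ∑ a ∈ range (e + 1),
      C (dppWeight x y (c + 1) a) *
        (N * Q ^ min (c + 1) a * (1 + C y * X * Q) ^ (a - (c + 1))) := by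
  induction e with
  | zero =>
    simp [dppWeight]
    linear_combination hN
  | succ e ih =>
    rw [Finset.sum_range_succ, mul_add, ← add_assoc, ← ih]
    rcases Nat.lt_or_ge e c with hec | hec
    · rw [min_eq_right (by omega), min_eq_right (by omega), min_eq_right (by omega),
        Nat.sub_eq_zero_of_le (by omega), Nat.sub_eq_zero_of_le (by omega),
        Nat.sub_eq_zero_of_le (by omega), dppWeight, if_neg (by omega), if_pos (by omega)]
      linear_combination N * Q ^ e * hQ
    · rw [min_eq_left (by omega), min_eq_left (by omega), min_eq_left (by omega),
        Nat.sub_add_comm hec, Nat.add_sub_add_right, dppWeight, if_neg (by omega), if_neg (by omega)]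
      ring

theorem mk_pathWeight_eq (x y : R) {N Q : R⟦X⟧} (hN : N * (1 - X) = 1)
    (hQ : Q * (1 - C x * X) = 1) (c e : ℕ) :
    PowerSeries.mk (fun d => pathWeight (dppWeight x y) d c e) =
      N * Q ^ min c e * (1 + C y * X * Q) ^ (e - c) := by
  ext d
  rw [coeff_mk]
  induction d generalizing c e with
  | zero =>
    rw [inv_one_sub_eq_one_add_sum x y hN hQ]
    simp [pathWeight]
  | succ d ih =>
    rw [inv_one_sub_eq_one_add_sum x y hN hQ, map_add, coeff_succ_X_mul, map_sum, pathWeight]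
    simp only [coeff_C_mul, ← ih]
    simp [coeff_one]

/-- The bivariate power series `∑ p k v ^ k` where `p k` is a power series in `u`. -/
noncomputable def columnSeries (p : ℕ → R⟦X⟧) : MvPowerSeries (Fin 2) R :=
  fun m => coeff (m 0) (p (m 1))

theorem coeff_columnSeries (p : ℕ → R⟦X⟧) (m : Fin 2 →₀ ℕ) :
    MvPowerSeries.coeff m (columnSeries p) = coeff (m 0) (p (m 1)) := rfl

theorem columnSeries_sub (p q : ℕ → R⟦X⟧) :
    columnSeries p - columnSeries q = columnSeries (fun k => p k - q k) := by
  ext m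
  simp [coeff_columnSeries]

theorem columnSeries_mul_C (p : ℕ → R⟦X⟧) (r : R) :
    columnSeries p * MvPowerSeries.C r = columnSeries (fun k => p k * C r) := by
  ext m
  simp [coeff_columnSeries]

theorem columnSeries_mul_X_zero (p : ℕ → R⟦X⟧) :
    columnSeries p * MvPowerSeries.X 0 = columnSeries (fun k => p k * X) := by
  ext m
  rw [MvPowerSeries.X, MvPowerSeries.coeff_mul_monomial, coeff_columnSeries, coeff_columnSeries]
  simp only [Finsupp.single_le_iff]
  rcases h : m 0 with _ | l
  · simp
  · simp [coeff_succ_mul_X, h]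

theorem columnSeries_mul_X_one (p : ℕ → R⟦X⟧) :
    columnSeries p * MvPowerSeries.X 1 =
      columnSeries (fun k => Nat.casesOn k 0 p) := by
  ext m
  rw [MvPowerSeries.X, MvPowerSeries.coeff_mul_monomial, coeff_columnSeries, coeff_columnSeries]
  simp only [Finsupp.single_le_iff]
  rcases h : m 1 with _ | l
  · simp
  · simp [h]

theorem columnSeries_one : columnSeries (fun k => Nat.casesOn k (1 : R⟦X⟧) 0) = 1 := by
  ext m
  rw [coeff_columnSeries, MvPowerSeries.coeff_one]
  rcases h : m 1 with _ | l
  · rcases h' : m 0 with _ | l'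
    · have : m = 0 := by
        ext i
        fin_cases i <;> simp [h, h']
      simp [this]
    · have : m ≠ 0 := by
        rintro rfl
        simp at h'
      simp [this, coeff_one]
  · have : m ≠ 0 := by
      rintro rfl
      simp at h
    simp [this]

/-- The infinite matrix whose principal minors enumerate descending plane partitions: the entry
`(l, k)` is the weight of the rows with first part `k + 1` which, padded by zeros, have length
`l`. -/
def rowMatrix (x y : R) : Matrix ℕ ℕ R := fun l k =>
  if l = 0 then 0 else y * pathWeight (dppWeight x y) (l - 1) 1 (k + 1)

theorem matrixGenFun_rowMatrix (x y : R) {N Q : R⟦X⟧} (hN : N * (1 - X) = 1)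
    (hQ : Q * (1 - C x * X) = 1) :
    matrixGenFun (rowMatrix x y) =
      columnSeries (fun k => N * Q * (1 + C y * X * Q) ^ k * C y * X) := by
  have h : ∀ k, N * Q * (1 + C y * X * Q) ^ k =
      PowerSeries.mk (fun d => pathWeight (dppWeight x y) d 1 (k + 1)) := fun k => by
    rw [mk_pathWeight_eq x y hN hQ]
    simp
  ext m
  rw [coeff_columnSeries, h]
  change rowMatrix x y (m 0) (m 1) = _
  rcases m 0 with _ | l
  · simp [rowMatrix]
  · rw [coeff_succ_mul_X, coeff_mul_C, coeff_mk]
    simp [rowMatrix, mul_comm]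

theorem matrixGenFun_one_mul : matrixGenFun (1 : Matrix ℕ ℕ R) *
    (1 - MvPowerSeries.X 0 * MvPowerSeries.X 1) = 1 := by
  have h : matrixGenFun (1 : Matrix ℕ ℕ R) = columnSeries (fun k => X ^ k) := by
    ext m
    rw [coeff_columnSeries, coeff_X_pow]
    exact Matrix.one_apply
  rw [h, mul_sub, mul_one, ← mul_assoc, columnSeries_mul_X_zero, columnSeries_mul_X_one,
    columnSeries_sub, ← columnSeries_one]
  congr 1
  funext k
  cases k with
  | zero => simp
  | succ k => simp [pow_succ]

/-- The columns form a geometric progression in v with ratio 1 + yuQ = (1 + (y - x)u) / (1 - xu),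
where Q = 1 / (1 - xu). Hence clearing denominators leaves only the coefficient of v^0. -/
theorem matrixGenFun_rowMatrix_mul (x y : R) :
    matrixGenFun (rowMatrix x y) * ((1 - MvPowerSeries.X 0) *
      (1 - MvPowerSeries.C x * MvPowerSeries.X 0 - MvPowerSeries.X 1 -
        MvPowerSeries.C (y - x) * MvPowerSeries.X 0 * MvPowerSeries.X 1)) =
      MvPowerSeries.C y * MvPowerSeries.X 0 := by
  obtain ⟨N, hN⟩ : ∃ N : R⟦X⟧, N * (1 - X) = 1 := ⟨_, mk_one_mul_one_sub_eq_one R⟩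
  obtain ⟨Q, hQ⟩ : ∃ Q : R⟦X⟧, Q * (1 - C x * X) = 1 :=
    ⟨PowerSeries.invOfUnit (1 - C x * X) 1, by
      rw [mul_comm, PowerSeries.mul_invOfUnit _ _ (by simp)]⟩
  rw [matrixGenFun_rowMatrix x y hN hQ, ← mul_assoc]
  simp only [mul_sub, mul_one, ← mul_assoc, columnSeries_mul_X_zero, columnSeries_mul_X_one,
    columnSeries_mul_C, columnSeries_sub]
  rw [← one_mul (MvPowerSeries.C y), ← columnSeries_one, columnSeries_mul_C,
    columnSeries_mul_X_zero]
  congr 1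
  funext k
  cases k with
  | zero =>
    simp only [pow_zero, map_sub, Nat.rec_zero]
    linear_combination (C y * X * Q * (1 - C x * X)) * hN + (C y * X) * hQ
  | succ k =>
    simp only [pow_succ, map_sub, Pi.zero_apply]
    linear_combination (N * Q * (1 + C y * X * Q) ^ k * C y * X * (1 - X) * C y * X) * hQ

theorem matrixGenFun_add (A B : Matrix ℕ ℕ R) :
    matrixGenFun (A + B) = matrixGenFun A + matrixGenFun B := rfl

theorem matrixGenFun_injective {S : Type*} : Function.Injective (matrixGenFun (R := S)) := by
  intro A B h
  ext i j
  have := congrFun h (Finsupp.single 0 i + Finsupp.single 1 j)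
  simpa [matrixGenFun] using this

theorem matrixGenFun_one_add_rowMatrix (x y : R) :
    matrixGenFun (1 + rowMatrix x y) = dppGenFun x y := by
  have cancel : ∀ {φ ψ : MvPowerSeries (Fin 2) R}, MvPowerSeries.constantCoeff φ = 1 →
      ψ * φ = 1 → ψ = MvPowerSeries.invOfUnit φ 1 := fun {φ ψ} h h1 => by
    rw [← mul_one ψ, ← MvPowerSeries.mul_invOfUnit φ 1 (by simpa using h), ← mul_assoc, h1,
      one_mul]
  have h2 : (1 - MvPowerSeries.X 0 : MvPowerSeries (Fin 2) R) *
      MvPowerSeries.invOfUnit (1 - MvPowerSeries.X 0) 1 = 1 :=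
    MvPowerSeries.mul_invOfUnit _ 1 (by simp)
  have h3 := MvPowerSeries.mul_invOfUnit (1 - MvPowerSeries.C x * MvPowerSeries.X 0 -
    MvPowerSeries.X 1 - MvPowerSeries.C (y - x) * MvPowerSeries.X 0 * MvPowerSeries.X 1 :
      MvPowerSeries (Fin 2) R) 1 (by simp)
  have h4 := matrixGenFun_rowMatrix_mul x y
  rw [matrixGenFun_add, dppGenFun, cancel (by simp) matrixGenFun_one_mul]
  congr 1
  dsimp only
  rw [← h4]
  generalize matrixGenFun (rowMatrix x y) = F at *
  generalize MvPowerSeries.invOfUnit (1 - MvPowerSeries.X 0 : MvPowerSeries (Fin 2) R) 1 = I at *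
  generalize (1 - MvPowerSeries.C x * MvPowerSeries.X 0 -
    MvPowerSeries.X 1 - MvPowerSeries.C (y - x) * MvPowerSeries.X 0 * MvPowerSeries.X 1 :
      MvPowerSeries (Fin 2) R) = D at *
  generalize MvPowerSeries.invOfUnit D 1 = J at *
  linear_combination -F * (D * J) * h2 - F * h3

end GeneratingFunction

/-! ### Descending plane partitions as path arrays -/

namespace DPP

/-- The rows of a descending plane partition, padded by zeros, as an array with left-justified rows
numbered from `0` and columns numbered from `1`. -/
def rowArray (A : DPP) : ℕ → ℕ → ℕ := fun k c => A.part (k + 1) (k + c)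

theorem part_pos_iff (A : DPP) {i j : ℕ} :
    0 < A.part i j ↔ 1 ≤ i ∧ i ≤ A.numRows ∧ i ≤ j ∧ j ≤ A.mu i := by
  refine ⟨fun h => ?_, fun h => A.part_pos i j h.1 h.2.1 h.2.2.1 h.2.2.2⟩
  by_contra h'
  rw [A.part_eq_zero i j h'] at h
  omega

theorem rowArray_pos_iff (A : DPP) {k c : ℕ} :
    0 < A.rowArray k c ↔ k < A.numRows ∧ 1 ≤ c ∧ k + c ≤ A.mu (k + 1) := by
  rw [rowArray, part_pos_iff]
  omega

theorem isPathArray_rowArray (A : DPP) {s : ℕ → ℕ} {r : ℕ} (hr : A.numRows = r)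
    (hs : ∀ k, k < r → A.part (k + 1) (k + 1) = s k + 1) :
    IsPathArray s 1 r (fun k => s k + 1) A.rowArray := by
  subst hr
  have hmu : ∀ k, k < A.numRows → A.mu (k + 1) ≤ k + s k := fun k hk => by
    have h1 := A.lam_lt_diag (k + 1) (by omega) (by omega)
    have h2 := hs k hk
    omega
  refine ⟨fun k c h => ?_, fun k hk => hs k hk, fun k c hk h1 h2 => ?_, fun k c hk h1 h2 => ?_⟩
  · by_contra hne
    have h1 := A.rowArray_pos_iff.1 (Nat.pos_of_ne_zero hne)
    have h2 := hmu k h1.1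
    omega
  · rcases Nat.eq_zero_or_pos (A.rowArray k (c + 1)) with h0 | h0
    · omega
    · have h3 := A.rowArray_pos_iff.1 h0
      exact A.row_weak (k + 1) (k + c) (by omega) (by omega) (by omega) (by omega)
  · have h3 := A.diag_succ_le_lam (k + 1) (by omega) (by omega)
    have h4 := hs (k + 1) hk
    -- Where the lower row is padding, the upper entry is still positive: c + 1 ≤ s (k + 1) + 1 =
    -- a_{k+2,k+2} ≤ λ_{k+1}.
    rcases Nat.eq_zero_or_pos (A.rowArray (k + 1) c) with h0 | h0
    · rw [h0, rowArray_pos_iff]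
      omega
    · have h5 := A.rowArray_pos_iff.1 h0
      have h6 := A.col_strict (k + 1) (k + 1 + c) (by omega) (by omega) (by omega) h5.2.2
      rw [rowArray, rowArray, show k + (c + 1) = k + 1 + c by omega]
      exact h6

theorem ext_of_rowArray {A B : DPP} (hr : A.numRows = B.numRows)
    (h : A.rowArray = B.rowArray) : A = B := by
  have hpart : ∀ i j, A.part i j = B.part i j := fun i j => by
    by_cases hij : 1 ≤ i ∧ i ≤ j
    · have := congrFun (congrFun h (i - 1)) (j + 1 - i)
      rwa [rowArray, rowArray, show i - 1 + 1 = i by omega,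
        show i - 1 + (j + 1 - i) = j by omega] at this
    · rw [A.part_eq_zero i j (by omega), B.part_eq_zero i j (by omega)]
  refine DPP.ext hr (funext fun i => ?_) (funext fun i => funext fun j => hpart i j)
  by_cases hi : 1 ≤ i ∧ i ≤ A.numRows
  · have hA := A.le_mu i hi.1 hi.2
    have hB := B.le_mu i hi.1 (by omega)
    have h1 := A.part_pos_iff (i := i) (j := A.mu i)
    have h2 := B.part_pos_iff (i := i) (j := B.mu i)
    rw [hpart, part_pos_iff] at h1
    rw [← hpart, part_pos_iff] at h2
    omega
  · rw [A.mu_eq_zero i hi, B.mu_eq_zero i (by omega)]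

end DPP

namespace IsPathArray

variable {s : ℕ → ℕ} {r : ℕ} {h : ℕ → ℕ → ℕ}

theorem antitone_row (hh : IsPathArray s 1 r (fun k => s k + 1) h) {k c c' : ℕ} (hk : k < r)
    (hc : 1 ≤ c) (hcc : c ≤ c') : h k c' ≤ h k c := by
  induction c', hcc using Nat.le_induction with
  | base => rfl
  | succ m hm ih =>
    refine le_trans ?_ ih
    by_cases hms : m + 1 ≤ s k
    · exact hh.row k m hk (by omega) hms
    · rw [hh.eq_zero k (m + 1) (by omega)]
      omega

theorem exists_length (hh : IsPathArray s 1 r (fun k => s k + 1) h) (k : ℕ) :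
    ∃ L, k < r → L ≤ s k ∧ ∀ c, 0 < h k c ↔ 1 ≤ c ∧ c ≤ L := by
  by_cases hk : k < r
  · refine ⟨Nat.findGreatest (fun c => 0 < h k c) (s k), fun _ => ⟨Nat.findGreatest_le _, ?_⟩⟩
    intro c
    constructor
    · intro hc
      have h1 : k < r ∧ 1 ≤ c ∧ c ≤ s k := by
        by_contra h1
        rw [hh.eq_zero k c h1] at hc
        omega
      exact ⟨h1.2.1, Nat.le_findGreatest (P := fun c => 0 < h k c) h1.2.2 hc⟩
    · rintro ⟨h1, h2⟩
      exact lt_of_lt_of_le (Nat.findGreatest_of_ne_zero (P := fun c => 0 < h k c) rfl (by omega))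
        (hh.antitone_row hk h1 h2)
  · exact ⟨0, fun h => absurd h hk⟩

theorem exists_dpp (hh : IsPathArray s 1 r (fun k => s k + 1) h) (hs : ∀ k, k < r → 1 ≤ s k) :
    ∃ A : DPP, A.numRows = r ∧ A.rowArray = h := by
  choose L hL using hh.exists_length
  have hL1 : ∀ k, k < r → 1 ≤ L k := fun k hk =>
    (((hL k hk).2 1).1 (by rw [hh.start k hk]; omega)).2
  -- Strictness in the last padded column of the lower row forces a positive entry above it. This
  -- gives both a_{i+1,i+1} ≤ λ_i and the monotonicity of `mu`.
  have hLs : ∀ k, k + 1 < r → s (k + 1) + 1 ≤ L k := fun k hk =>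
    (((hL k (by omega)).2 _).1
      (lt_of_le_of_lt (Nat.zero_le _) (hh.col k (s (k + 1)) hk (hs _ hk) le_rfl))).2
  refine ⟨
    { numRows := r
      mu := fun i => if 1 ≤ i ∧ i ≤ r then i - 1 + L (i - 1) else 0
      part := fun i j => if 1 ≤ i ∧ i ≤ j then h (i - 1) (j + 1 - i) else 0
      mu_eq_zero := fun i hi => if_neg hi
      part_eq_zero := ?_
      le_mu := ?_
      mu_succ_le := ?_
      part_pos := ?_
      row_weak := ?_
      col_strict := ?_
      lam_lt_diag := ?_
      diag_succ_le_lam := ?_ }, rfl, ?_⟩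
  · intro i j hij
    split_ifs at hij ⊢ with h1 h2
    · by_contra hne
      have := ((hL (i - 1) (by omega)).2 _).1 (Nat.pos_of_ne_zero hne)
      omega
    · exact hh.eq_zero _ _ (by omega)
    · rfl
    · rfl
  · intro i h1 h2
    have := hL1 (i - 1) (by omega)
    rw [if_pos ⟨h1, h2⟩]
    omega
  · intro i h1 h2
    rw [if_pos (by omega), if_pos (by omega)]
    have h3 := hLs (i - 1) (by omega)
    rw [show i - 1 + 1 = i by omega] at h3
    have h4 := (hL i (by omega)).1
    rw [show i + 1 - 1 = i by omega]
    omega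
  · intro i j h1 h2 h3 h4
    rw [if_pos (by omega)] at h4
    rw [if_pos (by omega), (hL (i - 1) (by omega)).2]
    omega
  · intro i j h1 h2 h3 h4
    rw [if_pos (by omega), if_pos (by omega)]
    exact hh.antitone_row (by omega) (by omega) (by omega)
  · intro i j h1 h2 h3 h4
    rw [if_pos (by omega)] at h4
    rw [if_pos (by omega), if_pos (by omega)]
    have h5 := hL i (by omega)
    rw [show i + 1 - 1 = i by omega] at h4 ⊢
    have h6 := hh.col (i - 1) (j - i) (by omega) (by omega)
      (by rw [show i - 1 + 1 = i by omega]; omega)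
    rw [show i - 1 + 1 = i by omega] at h6
    rwa [show j + 1 - (i + 1) = j - i by omega, show j + 1 - i = j - i + 1 by omega]
  · intro i h1 h2
    rw [if_pos (by omega), if_pos (by omega), show i + 1 - i = 1 by omega,
      hh.start (i - 1) (by omega)]
    have := (hL (i - 1) (by omega)).1
    dsimp only
    omega
  · intro i h1 h2
    rw [if_pos (by omega), if_pos (by omega), show i + 1 + 1 - (i + 1) = 1 by omega,
      show i + 1 - 1 = i by omega, hh.start i (by omega)]
    have h3 := hLs (i - 1) (by omega)
    rw [show i - 1 + 1 = i by omega] at h3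
    dsimp only
    omega
  · funext k c
    simp only [DPP.rowArray]
    by_cases hc : 1 ≤ c
    · rw [if_pos (by omega)]
      congr 1
      omega
    · rw [if_neg (by omega), hh.eq_zero k c (by omega)]

end IsPathArray

/-! ### Weights and diagonal parts -/

namespace DPP

theorem weight_eq_prod_rows {R : Type*} [CommRing R] (x y : R) (A : DPP) :
    x ^ A.numSpecial * y ^ A.numNonSpecial = ∏ k ∈ range A.numRows,
      ∏ c ∈ Icc 1 (A.mu (k + 1) - k), dppWeight x y c (A.rowArray k c) := by
  rw [numSpecial, numNonSpecial, ← Finset.prod_pow_eq_pow_sum, ← Finset.prod_pow_eq_pow_sum,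
    ← Finset.prod_mul_distrib]
  symm
  refine Finset.prod_nbij' (fun k => k + 1) (fun i => i - 1) ?_ ?_ ?_ ?_ ?_
  · intro k hk
    rw [mem_range] at hk
    rw [mem_Icc]
    omega
  · intro i hi
    rw [mem_Icc] at hi
    rw [mem_range]
    omega
  · intro k _
    omega
  · intro i hi
    rw [mem_Icc] at hi
    omega
  · intro k hk
    rw [mem_range] at hk
    have hmu := A.le_mu (k + 1) (by omega) (by omega)
    rw [← Finset.prod_const, ← Finset.prod_const, ← Finset.prod_ite]
    refine Finset.prod_nbij' (fun c => k + c) (fun j => j - k) ?_ ?_ ?_ ?_ ?_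
    · intro c hc
      rw [mem_Icc] at hc ⊢
      omega
    · intro c hc
      rw [mem_Icc] at hc ⊢
      omega
    · intro c _
      omega
    · intro c hc
      rw [mem_Icc] at hc
      omega
    · intro c hc
      rw [mem_Icc] at hc
      have hpos : 0 < A.rowArray k c := A.rowArray_pos_iff.2 (by omega)
      rw [dppWeight, if_neg (by omega)]
      -- With j - i = c - 1, the condition a ≤ j - i for a special part becomes a < c.
      refine if_congr ?_ rfl rfl
      rw [rowArray]
      omega

/-- The first part of a row is never special, which accounts for `y ^ r`; padding zeros have weight
`1`. -/
theorem weight_eq_arrayWeight {R : Type*} [CommRing R] (x y : R) (A : DPP) {s : ℕ → ℕ} {r : ℕ}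
    (hr : A.numRows = r) (hs : ∀ k, k < r → A.part (k + 1) (k + 1) = s k + 1) :
    x ^ A.numSpecial * y ^ A.numNonSpecial =
      y ^ r * arrayWeight (dppWeight x y) s 1 r A.rowArray := by
  subst hr
  rw [weight_eq_prod_rows, arrayWeight]
  nth_rw 2 [← card_range A.numRows]
  rw [← Finset.prod_const, ← Finset.prod_mul_distrib]
  refine Finset.prod_congr rfl fun k hk => ?_
  rw [mem_range] at hk
  have h1 := A.lam_lt_diag (k + 1) (by omega) (by omega)
  have h2 := A.le_mu (k + 1) (by omega) (by omega)
  have h3 := hs k hk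
  have hy : dppWeight x y 1 (A.rowArray k 1) = y := by
    rw [dppWeight, rowArray, if_neg (by omega), if_neg (by omega)]
  nth_rw 2 [← hy]
  rw [← Finset.prod_insert (f := fun c => dppWeight x y c (A.rowArray k c)) (by simp)]
  refine Finset.prod_subset (fun c hc => ?_) fun c hc hc' => ?_
  · rw [mem_Icc] at hc
    rw [mem_insert, mem_Ioc]
    omega
  · rw [mem_insert, mem_Ioc] at hc
    rw [mem_Icc] at hc'
    have h0 : ¬ 0 < A.rowArray k c := fun h => by
      have := A.rowArray_pos_iff.1 h
      omega
    rw [dppWeight, if_pos (by omega)]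

/-- The set of the numbers `a_{i,i} - 1` in `{0, …, n - 1}`. -/
def diagSet (A : DPP) (n : ℕ) : Finset (Fin n) :=
  univ.filter fun i => ∃ k ∈ range A.numRows, A.part (k + 1) (k + 1) = i + 1

theorem one_lt_diag (A : DPP) {k : ℕ} (hk : k < A.numRows) : 1 < A.part (k + 1) (k + 1) := by
  have h1 := A.lam_lt_diag (k + 1) (by omega) (by omega)
  have h2 := A.le_mu (k + 1) (by omega) (by omega)
  omega

theorem diag_lt_diag (A : DPP) {k l : ℕ} (hkl : k < l) (hl : l < A.numRows) :
    A.part (l + 1) (l + 1) < A.part (k + 1) (k + 1) := by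
  induction l, hkl using Nat.le_induction with
  | base =>
    have h1 := A.lam_lt_diag (k + 1) (by omega) (by omega)
    have h2 := A.diag_succ_le_lam (k + 1) (by omega) (by omega)
    exact lt_of_le_of_lt h2 h1
  | succ l _ ih =>
    have h1 := A.lam_lt_diag (l + 1) (by omega) (by omega)
    have h2 := A.diag_succ_le_lam (l + 1) (by omega) (by omega)
    have h3 := ih (by omega)
    omega

end DPP

/-! ### Principal minors and the sum over diagonal sets -/

theorem Finset.exists_decreasing_enumeration {n : ℕ} (S : Finset (Fin n)) :
    ∃ (s : ℕ → ℕ) (φ : Fin S.card ≃ S), (∀ k, ((φ k : Fin n) : ℕ) = s k) ∧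
      ∀ k l, k < l → l < S.card → s l < s k := by
  let φ : Fin S.card ≃ S := Fin.revPerm.trans (S.orderIsoOfFin rfl).toEquiv
  refine ⟨fun k => if hk : k < S.card then ((φ ⟨k, hk⟩ : Fin n) : ℕ) else 0, φ, ?_, ?_⟩
  · intro k
    simp
  · intro k l hkl hl
    dsimp only
    rw [dif_pos hl, dif_pos (by omega)]
    have : φ ⟨l, hl⟩ < φ ⟨k, by omega⟩ := by
      simp only [φ, Equiv.trans_apply, RelIso.coe_fn_toEquiv, OrderIso.lt_iff_lt,
        Fin.revPerm_apply, Fin.rev_lt_rev]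
      exact hkl
    exact this

/-- Read backwards, both sequences are the unique increasing enumeration of their common image. -/
theorem eq_of_decreasing_of_image_eq {s t : ℕ → ℕ} {r r' : ℕ}
    (hs : ∀ k l, k < l → l < r → s l < s k) (ht : ∀ k l, k < l → l < r' → t l < t k)
    (h : (range r).image s = (range r').image t) :
    r = r' ∧ ∀ k, k < r → s k = t k := by
  have hcard : ∀ {u : ℕ → ℕ} {m : ℕ}, (∀ k l, k < l → l < m → u l < u k) →
      ((range m).image u).card = m := fun {u m} hu => by
    rw [Finset.card_image_of_injOn, card_range]
    intro a ha b hb hab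
    simp only [coe_range, Set.mem_Iio] at ha hb
    rcases lt_trichotomy a b with h1 | h1 | h1
    · have := hu a b h1 hb
      omega
    · exact h1
    · have := hu b a h1 ha
      omega
  obtain rfl : r = r' := by rw [← hcard hs, h, hcard ht]
  refine ⟨rfl, fun k hk => ?_⟩
  have key : ∀ {u : ℕ → ℕ} (hu : ∀ k l, k < l → l < r → u l < u k)
      (hu' : (range r).image s = (range r).image u),
      (fun i : Fin r => u i.rev) = ((range r).image s).orderEmbOfFin (hcard hs) := by
    intro u hu hu'
    refine Finset.orderEmbOfFin_unique _ (fun i => ?_) fun i j hij => ?_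
    · rw [hu']
      exact mem_image_of_mem _ (mem_range.2 (Fin.is_lt _))
    · exact hu _ _ (Fin.rev_lt_rev.2 hij) (Fin.is_lt _)
  have := congrFun ((key hs rfl).trans (key ht h).symm) (Fin.rev ⟨k, hk⟩)
  simpa using this

/-- By multilinearity in the rows; `S` records which rows are taken from `M`. -/
theorem Matrix.det_one_add_eq_sum_principal_minors {R ι : Type*} [CommRing R] [Fintype ι]
    [DecidableEq ι] (M : Matrix ι ι R) :
    (1 + M).det = ∑ S : Finset ι, (M.submatrix (↑) (↑) : Matrix S S R).det := by
  rw [add_comm]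
  refine ((Matrix.detRowAlternating (n := ι) (R := R)).map_add_univ M.row
    (1 : Matrix ι ι R).row).trans ?_
  exact Finset.sum_congr rfl fun S _ => Matrix.det_piecewise_one_eq_submatrix_det M S

/-- `rowMatrix` is indexed by (end, start) and the path matrix by (start, end), hence a transpose.
-/
theorem det_rowMatrix {R : Type*} [CommRing R] (x y : R) {s : ℕ → ℕ} {r : ℕ}
    (hs : ∀ k, k < r → 1 ≤ s k) :
    (Matrix.of fun k l : Fin r => rowMatrix x y (s k) (s l)).det = y ^ r *
      (Matrix.of fun k l : Fin r =>
        pathWeight (dppWeight x y) (s l - 1) 1 (s k + 1)).det := by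
  rw [← Matrix.det_transpose]
  have h := Matrix.det_smul (Matrix.of fun k l : Fin r =>
    pathWeight (dppWeight x y) (s l - 1) 1 (s k + 1)) y
  rw [Fintype.card_fin] at h
  rw [← h]
  congr 1
  ext k l
  have := hs l l.2
  simp [rowMatrix, show s l ≠ 0 by omega]

namespace DPP

theorem image_eq_of_diagSet_eq {A : DPP} {n : ℕ} (hA : A.IsOfOrder n) {S : Finset (Fin n)}
    (hS : A.diagSet n = S) :
    (range A.numRows).image (fun k => A.part (k + 1) (k + 1) - 1) = S.map Fin.valEmbedding := by
  ext a
  simp only [← hS, diagSet, mem_image, mem_map, mem_filter, mem_univ, true_and, mem_range,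
    Fin.valEmbedding_apply]
  constructor
  · rintro ⟨k, hk, rfl⟩
    have h1 := A.one_lt_diag hk
    have h2 := hA (k + 1) (k + 1) (by omega) (by omega) le_rfl (A.le_mu _ (by omega) (by omega))
    exact ⟨⟨A.part (k + 1) (k + 1) - 1, by omega⟩, ⟨k, hk, by simp only; omega⟩, rfl⟩
  · rintro ⟨i, ⟨k, hk, hi⟩, rfl⟩
    exact ⟨k, hk, by omega⟩

theorem sum_weight_of_diagSet_eq {R : Type*} [CommRing R] (x y : R) {n : ℕ}
    (S : Finset (Fin n)) :
    ∑ A ∈ (finite_isOfOrder n).toFinset with A.diagSet n = S,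
        x ^ A.numSpecial * y ^ A.numNonSpecial =
      ((truncation (rowMatrix x y) n).submatrix (↑) (↑) : Matrix S S R).det := by
  obtain ⟨s, φ, hφ, hs⟩ := S.exists_decreasing_enumeration
  have hsimage : (range S.card).image s = S.map Fin.valEmbedding := by
    ext a
    simp only [mem_image, mem_range, mem_map, Fin.valEmbedding_apply]
    constructor
    · rintro ⟨k, hk, rfl⟩
      exact ⟨φ ⟨k, hk⟩, (φ ⟨k, hk⟩).2, hφ ⟨k, hk⟩⟩
    · rintro ⟨i, hi, rfl⟩
      refine ⟨φ.symm ⟨i, hi⟩, Fin.is_lt _, ?_⟩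
      rw [← hφ, Equiv.apply_symm_apply]
  have hfiber : ∀ A : DPP, A.IsOfOrder n → A.diagSet n = S →
      A.numRows = S.card ∧ ∀ k, k < S.card → A.part (k + 1) (k + 1) = s k + 1 := by
    intro A hA hAS
    obtain ⟨h1, h2⟩ := eq_of_decreasing_of_image_eq
      (s := fun k => A.part (k + 1) (k + 1) - 1) (t := s) (fun k l hkl hl => by
        have h1 := A.diag_lt_diag hkl hl
        have h2 := A.one_lt_diag hl
        omega) hs ((image_eq_of_diagSet_eq hA hAS).trans hsimage.symm)
    refine ⟨h1, fun k hk => ?_⟩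
    have h3 := h2 k (by omega)
    have h4 := A.one_lt_diag (k := k) (by omega)
    omega
  have hdet : ((truncation (rowMatrix x y) n).submatrix (↑) (↑) : Matrix S S R).det =
      (Matrix.of fun k l : Fin S.card => rowMatrix x y (s k) (s l)).det := by
    rw [← Matrix.det_submatrix_equiv_self φ]
    congr 1
    ext k l
    simp [truncation, hφ]
  rw [hdet]
  -- If 0 ∈ S, both sides vanish: row 0 of `rowMatrix` is zero, and every diagonal part exceeds 1.
  by_cases hpos : ∀ k, k < S.card → 1 ≤ s k
  · have hlt : ∀ k, k < S.card → s k < n := fun k hk => by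
      rw [← hφ ⟨k, hk⟩]
      exact Fin.is_lt _
    obtain ⟨F, hF, hsum⟩ := exists_finset_isPathArray (dppWeight x y) s n 1 S.card
      (fun k => s k + 1) (fun k l hkl => by
        rcases hkl.eq_or_lt with rfl | hkl
        · rfl
        · exact Nat.succ_le_succ (hs k l hkl l.2).le) hs
      fun k hk => ⟨hpos k hk, by have := hlt k hk; omega⟩
    rw [det_rowMatrix x y hpos, ← hsum, Finset.mul_sum]
    refine Finset.sum_bij (fun A _ => A.rowArray) ?_ ?_ ?_ ?_
    · intro A hA
      simp only [mem_filter, Set.Finite.mem_toFinset, Set.mem_ofPred_eq] at hA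
      obtain ⟨h1, h2⟩ := hfiber A hA.1 hA.2
      exact (hF _).2 (A.isPathArray_rowArray h1 h2)
    · intro A hA B hB hAB
      simp only [mem_filter, Set.Finite.mem_toFinset, Set.mem_ofPred_eq] at hA hB
      exact ext_of_rowArray
        ((hfiber A hA.1 hA.2).1.trans (hfiber B hB.1 hB.2).1.symm) hAB
    · intro h hh
      rw [hF] at hh
      obtain ⟨A, hr, rfl⟩ := hh.exists_dpp hpos
      have hdiag : ∀ k, k < S.card → A.part (k + 1) (k + 1) = s k + 1 := hh.start
      refine ⟨A, ?_, rfl⟩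
      simp only [mem_filter, Set.Finite.mem_toFinset, Set.mem_ofPred_eq]
      refine ⟨fun i j h1 h2 h3 h4 => ?_, ?_⟩
      -- Each part is at most the first part of its row, which is s (i - 1) + 1 ≤ n.
      · have h5 := hh.antitone_row (k := i - 1) (c := 1) (c' := j + 1 - i) (by omega) le_rfl
          (by omega)
        rw [hh.start (i - 1) (by omega), rowArray, show i - 1 + 1 = i by omega,
          show i - 1 + (j + 1 - i) = j by omega] at h5
        have h6 := hlt (i - 1) (by omega)
        dsimp only at h5
        omega
      · ext i
        simp only [diagSet, mem_filter, mem_univ, true_and, mem_range, hr]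
        constructor
        · rintro ⟨k, hk, hki⟩
          have h1 : (φ ⟨k, hk⟩ : Fin n) = i := Fin.ext (by
            rw [hφ]
            have := hdiag k hk
            dsimp only
            omega)
          rw [← h1]
          exact (φ ⟨k, hk⟩).2
        · intro hi
          refine ⟨φ.symm ⟨i, hi⟩, Fin.is_lt _, ?_⟩
          rw [hdiag _ (Fin.is_lt _), ← hφ, Equiv.apply_symm_apply]
    · intro A hA
      simp only [mem_filter, Set.Finite.mem_toFinset, Set.mem_ofPred_eq] at hA
      obtain ⟨h1, h2⟩ := hfiber A hA.1 hA.2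
      exact A.weight_eq_arrayWeight x y h1 h2
  · push Not at hpos
    obtain ⟨k, hk, hsk⟩ := hpos
    rw [Matrix.det_eq_zero_of_row_eq_zero (⟨k, hk⟩ : Fin S.card)
      (fun l => by simp [rowMatrix, show s k = 0 by omega])]
    refine Finset.sum_eq_zero fun A hA => ?_
    simp only [mem_filter, Set.Finite.mem_toFinset, Set.mem_ofPred_eq] at hA
    obtain ⟨h1, h2⟩ := hfiber A hA.1 hA.2
    have h3 := h2 k hk
    have h4 := A.one_lt_diag (k := k) (by omega)
    omega

theorem partitionFunction_eq_det {R : Type*} [CommRing R] (x y : R) (n : ℕ) :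
    partitionFunction x y n = (1 + truncation (rowMatrix x y) n).det := by
  rw [Matrix.det_one_add_eq_sum_principal_minors, partitionFunction,
    ← Finset.sum_fiberwise _ (fun A : DPP => A.diagSet n)]
  exact Finset.sum_congr rfl fun S _ => sum_weight_of_diagSet_eq x y S

end DPP

theorem mainTheorem3 {R : Type*} [CommRing R] (x y : R) :
    (∃! H : Matrix ℕ ℕ R, matrixGenFun (1 + H) = dppGenFun x y) ∧
    ∀ H : Matrix ℕ ℕ R, matrixGenFun (1 + H) = dppGenFun x y →
      ∀ n : ℕ, DPP.partitionFunction x y n = (1 + truncation H n).det := by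
  have huniq : ∀ H : Matrix ℕ ℕ R, matrixGenFun (1 + H) = dppGenFun x y → H = rowMatrix x y :=
    fun H hH => add_left_cancel
      (matrixGenFun_injective (hH.trans (matrixGenFun_one_add_rowMatrix x y).symm))
  refine ⟨⟨rowMatrix x y, matrixGenFun_one_add_rowMatrix x y, huniq⟩, fun H hH n => ?_⟩
  rw [huniq H hH]
  exact DPP.partitionFunction_eq_det x y n
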